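/- A three-step path consists of up-steps $(1,1)$, level steps $(1,0)$ and down-steps $(1,-1)$. For non-negative integers $m$ and $k$ let $MP_m(k)$ (the generalised Motzkin prefix number) be the number of three-step paths with $m$ steps that start at $(0,k)$ and never run below the $x$-axis, with arbitrary end point. Let $\binom{n}{a,b}=\frac{n!}{a!\,b!\,(n-a-b)!}$ denote the trinomial coefficient, read as $0$ if one of $a$, $b$, $n-a-b$ is negative. Then, for all positive integers $n$ and non-negative integers $k$, $$\det_{0\le i,j\le n-1}\bigl(MP_{i+j}(k)\bigr)=\det_{0\le i,j\le n-1}\Biggl(\sum_{\ell\ge0}\sum_{l=-k}^{k+1}\binom{i+j}{\ell,\ell+l}\Biggr)=\begin{cases}(-1)^{n_1\binom{k+1}{2}},&\text{if } n=(k+1)n_1,\\ (-1)^{n_1\binom{k+1}{2}},&\text{if } n=(k+1)n_1+1,\\ 0,&\text{if } n\not\equiv 0,1 \pmod{k+1},\end{cases}$$ where $n_1$ denotes a non-negative integer. In particular, for $k=0$, the Hankel determinant $\det_{0\le i,j\le n-1}(MP_{i+j}(0))$ of the Motzkin prefix numbers equals $1$ for every positive integer $n$. -/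

import Mathlib

/-- The height, after the first `j` steps, of the three-step path which starts at height `k` and
whose `i`-th step is the up-step `(1,1)`, the level step `(1,0)` or the down-step `(1,-1)`,
according to whether `s i` is `1`, `0` or `-1`. -/
def pathHeight (k : ℕ) {m : ℕ} (s : Fin m → SignType) (j : ℕ) : ℤ :=
  (k : ℤ) + ∑ i : Fin m, if (i : ℕ) < j then (s i : ℤ) else 0

/-- The generalised Motzkin prefix number `MP_m(k)`: the number of three-step paths with `m` steps
which start at height `k` and never run below the `x`-axis, with arbitrary end point. -/
def motzkinPrefix (m k : ℕ) : ℕ :=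
  Fintype.card {s : Fin m → SignType // ∀ j ≤ m, 0 ≤ pathHeight k s j}

/-- The trinomial coefficient `n! / (a! b! (n - a - b)!)`, which is zero if one of
`a`, `b`, `n - a - b` is negative. -/
def trinomial (n : ℕ) (a b : ℤ) : ℕ :=
  if 0 ≤ a ∧ 0 ≤ b ∧ a + b ≤ n then
    n.factorial / (a.toNat.factorial * b.toNat.factorial * ((n : ℤ) - a - b).toNat.factorial)
  else 0

/-- The sum of the trinomial coefficients of `m` with lower entries `ℓ` and `ℓ + l`, over all
`ℓ ≥ 0` and all `l` with `-k ≤ l ≤ k + 1`. The terms with `ℓ > m` vanish. -/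
noncomputable def trinomialSum (m k : ℕ) : ℕ :=
  ∑ ℓ ∈ Finset.range (m + 1), ∑ l ∈ Finset.Icc (-(k : ℤ)) ((k : ℤ) + 1),
    trinomial m (ℓ : ℤ) ((ℓ : ℤ) + l)

/-! Put K = k + 1, and let L(P) be the sum of the coefficients of z^l in P(z + 1 + z⁻¹) over the
window -k ≤ l ≤ k + 1. Then L(X^m) is the trinomial sum, and it equals MP_m(k) because both satisfy
the same recurrence (`motzkinPrefix_eq_prefixFunctional`). So the determinant is the Gram
determinant of L, and any monic basis with one polynomial in each degree may replace the powers of X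
(`det_gram_eq_of_monic`).

The basis is chosen so that the window sum collapses. The window has length 2K, so it pairs l with l
+ K, which suits a polynomial V_a with (1 + z^K) V_a = z^(K(a+1)) + z^(-Ka). The factor X - 3
becomes (z - 1)(1 - z⁻¹), so the window sum telescopes to the difference of two coefficients at
distance 2K, which suits U_a with (z^K - z^(-K)) U_a = z^(K(a+1)) - z^(-K(a+1)). Hence L(V_a P) and
L((X - 3) U_a P) are, up to sign, single coefficients of P when deg P is small
(`prefixFunctional_stepV_mul`, `prefixFunctional_stepU_mul`).

In the basis V_a, (X - 3) U_a X^s (s < k) the Gram matrix is therefore block upper triangular with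
blocks of size K. Each diagonal block consists of an entry 1 and a k × k antitriangular part with -1
on the antidiagonal, and so has determinant (-1)^(k(k+1)/2). A truncated last block of size 1
contributes 1; one of size 2, ..., k has a zero row. -/

/-! ### First-step recurrences for paths -/

theorem pathHeight_cons (k : ℕ) {m : ℕ} (e : SignType) (s : Fin m → SignType) (j : ℕ) :
    pathHeight k (Fin.cons e s : Fin (m + 1) → SignType) (j + 1) = pathHeight k s j + e := by
  simp only [pathHeight, Fin.sum_univ_succ, Fin.val_zero, Fin.cons_zero, Fin.cons_succ,
    Fin.val_succ, Nat.succ_pos, if_true, add_lt_add_iff_right]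
  ring

theorem pathHeight_zero (k : ℕ) {m : ℕ} (s : Fin m → SignType) : pathHeight k s 0 = k := by
  simp [pathHeight]

theorem pathHeight_succ_start (k : ℕ) {m : ℕ} (s : Fin m → SignType) (j : ℕ) :
    pathHeight (k + 1) s j = pathHeight k s j + 1 := by
  simp only [pathHeight]; push_cast; ring

theorem forall_pathHeight_cons_nonneg (k : ℕ) {m : ℕ} (e : SignType) (s : Fin m → SignType) :
    (∀ j ≤ m + 1, 0 ≤ pathHeight k (Fin.cons e s : Fin (m + 1) → SignType) j) ↔
      ∀ j ≤ m, 0 ≤ pathHeight k s j + e := by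
  constructor
  · intro h j hj
    rw [← pathHeight_cons]
    exact h _ (by omega)
  · rintro h (_ | j) hj
    · rw [pathHeight_zero]; positivity
    · rw [pathHeight_cons]; exact h j (by omega)

/-- Removing the first step `e` leaves a path starting at k + e. The shift stays inside the
inequality because k + e may be negative. -/
theorem motzkinPrefix_succ_eq_sum (m k : ℕ) :
    motzkinPrefix (m + 1) k = ∑ e : SignType,
      Nat.card {s : Fin m → SignType // ∀ j ≤ m, 0 ≤ pathHeight k s j + e} := by
  classical
  have e₁ : {s : Fin (m + 1) → SignType // ∀ j ≤ m + 1, 0 ≤ pathHeight k s j} ≃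
      Σ e : SignType, {s : Fin m → SignType // ∀ j ≤ m, 0 ≤ pathHeight k s j + e} :=
    { toFun := fun s => ⟨s.1 0, Fin.tail s.1, by
        rw [← forall_pathHeight_cons_nonneg, Fin.cons_self_tail]; exact s.2⟩
      invFun := fun s => ⟨Fin.cons s.1 s.2.1, (forall_pathHeight_cons_nonneg k _ _).2 s.2.2⟩
      left_inv := fun s => Subtype.ext (Fin.cons_self_tail _)
      right_inv := fun s => rfl }
  rw [motzkinPrefix, ← Nat.card_eq_fintype_card, Nat.card_congr e₁, Nat.card_sigma]

theorem motzkinPrefix_eq_natCard (m k : ℕ) :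
    motzkinPrefix m k = Nat.card {s : Fin m → SignType // ∀ j ≤ m, 0 ≤ pathHeight k s j} := by
  rw [motzkinPrefix, Nat.card_eq_fintype_card]

theorem sum_signType {M : Type*} [AddCommMonoid M] (f : SignType → M) :
    ∑ e, f e = f 0 + f (-1) + f 1 := by
  rw [SignType.univ_eq, Finset.sum_insert (by decide), Finset.sum_insert (by decide),
    Finset.sum_singleton, add_assoc]

theorem motzkinPrefix_succ_succ (m k : ℕ) :
    motzkinPrefix (m + 1) (k + 1) =
      motzkinPrefix m (k + 1) + motzkinPrefix m k + motzkinPrefix m (k + 2) := by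
  simp only [motzkinPrefix_succ_eq_sum, motzkinPrefix_eq_natCard, sum_signType,
    pathHeight_succ_start, SignType.coe_zero, SignType.coe_one, SignType.coe_neg, add_zero,
    add_neg_cancel_right]

theorem motzkinPrefix_succ_zero (m : ℕ) :
    motzkinPrefix (m + 1) 0 = motzkinPrefix m 0 + motzkinPrefix m 1 := by
  have : IsEmpty {s : Fin m → SignType // ∀ j ≤ m, 0 ≤ pathHeight 0 s j + (-1 : ℤ)} :=
    ⟨fun s => by have := s.2 0 (Nat.zero_le _); simp [pathHeight_zero] at this⟩
  simp only [motzkinPrefix_succ_eq_sum, motzkinPrefix_eq_natCard, sum_signType,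
    pathHeight_succ_start, SignType.coe_zero, SignType.coe_one, SignType.coe_neg, add_zero,
    Nat.card_of_isEmpty]

theorem motzkinPrefix_zero (k : ℕ) : motzkinPrefix 0 k = 1 := by
  rw [motzkinPrefix_eq_natCard, Nat.card_eq_one_iff_unique]
  refine ⟨inferInstance, ⟨⟨Fin.elim0, fun j _ => ?_⟩⟩⟩
  simp [pathHeight]

/-! ### Trinomial coefficients and displacement counts -/

theorem trinomial_natCast (a b c : ℕ) :
    (trinomial (a + b + c) a b : ℚ) =
      (a + b + c).factorial / (a.factorial * b.factorial * c.factorial) := by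
  have h : ((a + b + c : ℕ) : ℤ) - a - b = c := by push_cast; ring
  rw [trinomial, if_pos ⟨by positivity, by positivity, by push_cast; omega⟩, h]
  simp only [Int.toNat_natCast]
  rw [Nat.cast_div (((mul_dvd_mul_right (Nat.factorial_mul_factorial_dvd_factorial_add a b) _).trans
    (Nat.factorial_mul_factorial_dvd_factorial_add (a + b) c))) (by positivity)]
  push_cast
  rfl

theorem trinomial_of_not {n : ℕ} {a b : ℤ} (h : ¬(0 ≤ a ∧ 0 ≤ b ∧ a + b ≤ n)) :
    trinomial n a b = 0 := if_neg h

theorem trinomial_zero (a b : ℤ) : trinomial 0 a b = if a = 0 ∧ b = 0 then 1 else 0 := by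
  split_ifs with h
  · obtain ⟨rfl, rfl⟩ := h; simp [trinomial]
  · exact trinomial_of_not (by push_cast; omega)

theorem trinomial_succ (n : ℕ) (a b : ℤ) :
    trinomial (n + 1) a b = trinomial n (a - 1) b + trinomial n a (b - 1) + trinomial n a b := by
  by_cases h : 0 ≤ a ∧ 0 ≤ b ∧ a + b ≤ n + 1
  · obtain ⟨ha, hb, hab⟩ := h
    lift a to ℕ using ha
    lift b to ℕ using hb
    obtain ⟨c, hc⟩ : ∃ c, n + 1 = a + b + c := ⟨n + 1 - a - b, by omega⟩
    -- With a + b + c = n + 1, the three summands are a, b and c times n!/(a! b! c!), and the left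
    -- side is their sum; the factor makes the boundary cases vanish.
    have key₁ : (trinomial n ((a : ℤ) - 1) b : ℚ) = a * (n.factorial /
        (a.factorial * b.factorial * c.factorial)) := by
      rcases a with _ | a
      · rw [trinomial_of_not (by omega)]; simp
      · obtain rfl : n = a + b + c := by omega
        rw [show ((a + 1 : ℕ) : ℤ) - 1 = a by push_cast; ring, trinomial_natCast,
          Nat.factorial_succ]
        push_cast
        field_simp
    have key₂ : (trinomial n (a : ℤ) ((b : ℤ) - 1) : ℚ) = b * (n.factorial /
        (a.factorial * b.factorial * c.factorial)) := by
      rcases b with _ | b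
      · rw [trinomial_of_not (by omega)]; simp
      · obtain rfl : n = a + b + c := by omega
        rw [show ((b + 1 : ℕ) : ℤ) - 1 = b by push_cast; ring, trinomial_natCast,
          Nat.factorial_succ b]
        push_cast
        field_simp
    have key₃ : (trinomial n (a : ℤ) (b : ℤ) : ℚ) = c * (n.factorial /
        (a.factorial * b.factorial * c.factorial)) := by
      rcases c with _ | c
      · rw [trinomial_of_not (by omega)]; simp
      · obtain rfl : n = a + b + c := by omega
        rw [trinomial_natCast, Nat.factorial_succ c]
        push_cast
        field_simp
    have h₀ : (trinomial (n + 1) (a : ℤ) (b : ℤ) : ℚ) = (a + b + c) * (n.factorial /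
        (a.factorial * b.factorial * c.factorial)) := by
      have h₁ : ((n : ℚ) + 1) = a + b + c := by exact_mod_cast hc
      rw [hc, trinomial_natCast, ← hc, Nat.factorial_succ, ← h₁]
      push_cast
      ring
    have : (trinomial (n + 1) (a : ℤ) (b : ℤ) : ℚ) =
        trinomial n ((a : ℤ) - 1) b + trinomial n (a : ℤ) ((b : ℤ) - 1) +
          trinomial n (a : ℤ) (b : ℤ) := by
      rw [h₀, key₁, key₂, key₃]; ring
    exact_mod_cast this
  · rw [trinomial_of_not (by push_cast; omega), trinomial_of_not (by omega),
      trinomial_of_not (by omega), trinomial_of_not (by omega)]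

/-- The number of unrestricted three-step paths with `m` steps and total displacement `l`, as a
sum of trinomial coefficients. -/
def displacementCount (m : ℕ) (l : ℤ) : ℕ :=
  ∑ ℓ ∈ Finset.range (m + 1), trinomial m ℓ (ℓ + l)

theorem displacementCount_zero (l : ℤ) : displacementCount 0 l = if l = 0 then 1 else 0 := by
  simp only [displacementCount, zero_add, Finset.sum_range_one, trinomial_zero, Nat.cast_zero,
    true_and]

theorem displacementCount_eq_sum_range_add_two (m : ℕ) (l : ℤ) :
    displacementCount m l = ∑ ℓ ∈ Finset.range (m + 2), trinomial m ℓ (ℓ + l) := by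
  rw [Finset.sum_range_succ _ (m + 1), displacementCount, left_eq_add]
  exact trinomial_of_not (by push_cast; omega)

theorem displacementCount_succ (m : ℕ) (l : ℤ) :
    displacementCount (m + 1) l =
      displacementCount m (l - 1) + displacementCount m l + displacementCount m (l + 1) := by
  have h : displacementCount m (l + 1) =
      ∑ ℓ ∈ Finset.range (m + 2), trinomial m ((ℓ : ℤ) - 1) (ℓ + l) := by
    have h₀ : trinomial m (((0 : ℕ) : ℤ) - 1) ((0 : ℕ) + l) = 0 :=
      trinomial_of_not fun h => absurd h.1 (by simp)
    rw [Finset.sum_range_succ', h₀, add_zero, displacementCount]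
    refine Finset.sum_congr rfl fun ℓ _ => ?_
    congr 1 <;> push_cast <;> ring
  rw [h, displacementCount_eq_sum_range_add_two m l,
    displacementCount_eq_sum_range_add_two m (l - 1),
    displacementCount, ← Finset.sum_add_distrib, ← Finset.sum_add_distrib]
  refine Finset.sum_congr rfl fun ℓ _ => ?_
  rw [trinomial_succ, add_sub_assoc]
  ring

theorem trinomialSum_eq (m k : ℕ) :
    trinomialSum m k = ∑ l ∈ Finset.Icc (-(k : ℤ)) (k + 1), displacementCount m l :=
  Finset.sum_comm

/-! ### Coefficients after substituting z + 1 + z⁻¹ -/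

open Polynomial

/-- Substitution of `z + 1 + z⁻¹` for the variable of a polynomial. -/
noncomputable def stepEval : ℤ[X] →ₐ[ℤ] LaurentPolynomial ℤ :=
  aeval (LaurentPolynomial.T 1 + 1 + LaurentPolynomial.T (-1))

/-- The coefficient of `z ^ l` in `P (z + 1 + z⁻¹)`. -/
noncomputable def stepCoeff (P : ℤ[X]) (l : ℤ) : ℤ := (stepEval P).coeff l

theorem coeff_mul_T (f : LaurentPolynomial ℤ) (n l : ℤ) :
    (f * LaurentPolynomial.T n).coeff l = f.coeff (l - n) := by
  rw [LaurentPolynomial.T, AddMonoidAlgebra.coeff_mul_single_apply, mul_one, sub_eq_add_neg]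

theorem coeff_T_mul (f : LaurentPolynomial ℤ) (n l : ℤ) :
    (LaurentPolynomial.T n * f).coeff l = f.coeff (l - n) := by
  rw [mul_comm, coeff_mul_T]

theorem coeff_add_apply (f g : LaurentPolynomial ℤ) (l : ℤ) :
    (f + g).coeff l = f.coeff l + g.coeff l := rfl

theorem coeff_sub_apply (f g : LaurentPolynomial ℤ) (l : ℤ) :
    (f - g).coeff l = f.coeff l - g.coeff l := rfl

theorem stepEval_X :
    stepEval X = LaurentPolynomial.T 1 + 1 + LaurentPolynomial.T (-1) := aeval_X _

theorem stepCoeff_X_pow_succ (m : ℕ) (l : ℤ) :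
    stepCoeff (X ^ (m + 1)) l =
      stepCoeff (X ^ m) (l - 1) + stepCoeff (X ^ m) l + stepCoeff (X ^ m) (l + 1) := by
  rw [stepCoeff, pow_succ, map_mul, stepEval_X, mul_add, mul_add, mul_one, coeff_add_apply,
    coeff_add_apply, coeff_mul_T, coeff_mul_T, sub_neg_eq_add]
  rfl

theorem stepCoeff_one (l : ℤ) : stepCoeff 1 l = if l = 0 then 1 else 0 := by
  rw [stepCoeff, map_one, ← LaurentPolynomial.T_zero, LaurentPolynomial.T_apply]
  simp only [eq_comm]

theorem stepCoeff_X_pow (m : ℕ) (l : ℤ) : stepCoeff (X ^ m) l = displacementCount m l := by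
  induction m generalizing l with
  | zero => rw [pow_zero, stepCoeff_one, displacementCount_zero]; push_cast; rfl
  | succ m ih => rw [stepCoeff_X_pow_succ, ih, ih, ih, displacementCount_succ]; push_cast; ring

theorem stepCoeff_X_pow_of_le (m : ℕ) (l : ℤ) (h : (m : ℤ) ≤ l) :
    stepCoeff (X ^ m) l = if l = m then 1 else 0 := by
  induction m generalizing l with
  | zero => rw [pow_zero, stepCoeff_one]; rfl
  | succ m ih =>
    push_cast at h ⊢
    rw [stepCoeff_X_pow_succ, ih _ (by omega), ih _ (by omega), ih _ (by omega),
      if_neg (show l ≠ m by omega), if_neg (show l + 1 ≠ m by omega), add_zero, add_zero]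
    simp only [sub_eq_iff_eq_add]

/-- The element z + 1 + z⁻¹ is invariant under z ↦ z⁻¹. -/
theorem stepCoeff_neg (P : ℤ[X]) (l : ℤ) : stepCoeff P (-l) = stepCoeff P l := by
  have h : (LaurentPolynomial.invert.toAlgHom.comp stepEval : ℤ[X] →ₐ[ℤ] LaurentPolynomial ℤ) =
      stepEval := by
    refine Polynomial.algHom_ext ?_
    change LaurentPolynomial.invert (stepEval X) = stepEval X
    rw [stepEval_X]
    simp only [map_add, map_one, LaurentPolynomial.invert_T, neg_neg]
    ring
  rw [stepCoeff, ← LaurentPolynomial.invert_apply]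
  exact congrArg (fun f => AddMonoidAlgebra.coeff f l) (DFunLike.congr_fun h P)

/-- Only the term X^n can reach z^n, and it does so with coefficient 1. -/
theorem stepCoeff_of_natDegree_le (P : ℤ[X]) (n : ℕ) (h : P.natDegree ≤ n) :
    stepCoeff P n = P.coeff n := by
  have hP := P.as_sum_range_C_mul_X_pow' (Nat.lt_succ_of_le h)
  have hs : ∀ s : ℕ, (stepEval (C (P.coeff s) * X ^ s)).coeff n =
      P.coeff s * stepCoeff (X ^ s) n := by
    intro s
    rw [← smul_eq_C_mul, map_smul]
    rfl
  conv_lhs => rw [stepCoeff, hP, map_sum, AddMonoidAlgebra.coeff_sum, Finsupp.finsetSum_apply]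
  simp only [hs]
  rw [Finset.sum_eq_single_of_mem n (Finset.self_mem_range_succ n)]
  · rw [stepCoeff_X_pow_of_le _ _ le_rfl, if_pos rfl, mul_one]
  · intro s hsm hsn
    have := Finset.mem_range_succ_iff.1 hsm
    rw [stepCoeff_X_pow_of_le _ _ (by exact_mod_cast this), if_neg (by omega), mul_zero]

theorem stepCoeff_of_natDegree_lt (P : ℤ[X]) {l : ℤ} (h : P.natDegree < l) :
    stepCoeff P l = 0 := by
  lift l to ℕ using by omega
  rw [stepCoeff_of_natDegree_le _ _ (by omega), coeff_eq_zero_of_natDegree_lt (by omega)]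

/-! ### The moment functional -/

/-- The moment functional whose moments are the numbers `MP_m(k)`. -/
noncomputable def prefixFunctional (k : ℕ) (P : ℤ[X]) : ℤ :=
  ∑ l ∈ Finset.Icc (-(k : ℤ)) (k + 1), stepCoeff P l

theorem sum_Icc_eq_sum_range (f : ℤ → ℤ) (k : ℕ) :
    ∑ l ∈ Finset.Icc (-(k : ℤ)) (k + 1), f l = ∑ t ∈ Finset.range (2 * k + 2), f (t - k) := by
  refine (Finset.sum_bij' (fun (t : ℕ) _ => (t : ℤ) - k) (fun l _ => (l + k).toNat)
    ?_ ?_ ?_ ?_ ?_).symm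
  · intro t ht; simp only [Finset.mem_range, Finset.mem_Icc] at *; omega
  · intro t ht; simp only [Finset.mem_range, Finset.mem_Icc] at *; omega
  · intro t ht; simp
  · intro t ht; simp only [Finset.mem_Icc] at ht; rw [Int.toNat_of_nonneg (by omega)]; ring
  · intro t ht; rfl

theorem prefixFunctional_eq_sum_range (k : ℕ) (P : ℤ[X]) :
    prefixFunctional k P = ∑ t ∈ Finset.range (2 * k + 2), stepCoeff P (t - k) :=
  sum_Icc_eq_sum_range _ _

theorem prefixFunctional_X_pow (m k : ℕ) : prefixFunctional k (X ^ m) = trinomialSum m k := by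
  rw [trinomialSum_eq, prefixFunctional]
  push_cast
  exact Finset.sum_congr rfl fun l _ => stepCoeff_X_pow m l

/-- The window for k + 1, shifted by +1 and by -1, covers the same indices with multiplicity as the
windows for k and k + 2 together. This matches the first-step recurrence. For k = 0 the two shifts
of {0, 1} make up the window for 1. -/
theorem motzkinPrefix_eq_prefixFunctional (m k : ℕ) :
    (motzkinPrefix m k : ℤ) = prefixFunctional k (X ^ m) := by
  induction m generalizing k with
  | zero =>
    rw [motzkinPrefix_zero, prefixFunctional, pow_zero]
    simp only [stepCoeff_one]
    rw [Finset.sum_ite_eq', if_pos (by simp; omega)]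
    rfl
  | succ m ih =>
    simp only [prefixFunctional_eq_sum_range] at ih
    rcases k with _ | k
    · rw [motzkinPrefix_succ_zero]
      push_cast
      rw [ih, ih, prefixFunctional_eq_sum_range]
      simp only [stepCoeff_X_pow_succ]
      simp [Finset.sum_range_succ]
      ring
    · rw [motzkinPrefix_succ_succ]
      push_cast
      rw [ih, ih, ih, prefixFunctional_eq_sum_range]
      simp only [stepCoeff_X_pow_succ, Finset.sum_add_distrib]
      set f := stepCoeff (X ^ m)
      -- Both comparisons leave over the same two indices k + 2 and k + 3, which cancel at the end.
      have h₁ : ∑ t ∈ Finset.range (2 * (k + 1) + 2), f ((t : ℤ) - (k + 1 : ℕ) + 1) =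
          ∑ t ∈ Finset.range (2 * k + 2), f (t - k) + f (k + 2) + f (k + 3) := by
        rw [show 2 * (k + 1) + 2 = 2 * k + 2 + 1 + 1 by ring, Finset.sum_range_succ,
          Finset.sum_range_succ]
        congr 1
        · congr 1
          · refine Finset.sum_congr rfl fun t _ => ?_
            congr 1; push_cast; ring
          · congr 1; push_cast; ring
        · congr 1; push_cast; ring
      have h₂ : ∑ t ∈ Finset.range (2 * (k + 2) + 2), f ((t : ℤ) - (k + 2 : ℕ)) =
          ∑ t ∈ Finset.range (2 * (k + 1) + 2), f ((t : ℤ) - (k + 1 : ℕ) - 1) +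
            f (k + 2) + f (k + 3) := by
        rw [show 2 * (k + 2) + 2 = 2 * (k + 1) + 2 + 1 + 1 by ring, Finset.sum_range_succ,
          Finset.sum_range_succ]
        congr 1
        · congr 1
          · refine Finset.sum_congr rfl fun t _ => ?_
            congr 1; push_cast; ring
          · congr 1; push_cast; ring
        · congr 1; push_cast; ring
      rw [h₁, h₂]
      ring

/-! ### Determinant lemmas -/

namespace Matrix

theorem det_fin_add_of_lower_left_eq_zero (M : ℕ → ℕ → ℤ) (m r : ℕ)
    (h : ∀ i j, m ≤ i → j < m → M i j = 0) :
    (of fun i j : Fin (m + r) => M i j).det =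
      (of fun i j : Fin m => M i j).det * (of fun i j : Fin r => M (m + i) (m + j)).det := by
  rw [← det_reindex_self finSumFinEquiv.symm, ← det_fromBlocks_zero₂₁ _
    (of fun (i : Fin m) (j : Fin r) => M i (m + j))]
  congr 1
  ext (i | i) (j | j)
  · simp
  · simp
  · simpa using h _ _ (by omega) (by omega)
  · simp

theorem det_antitriangular (M : ℕ → ℕ → ℤ) (r : ℕ)
    (h₀ : ∀ i j, i + j + 1 < r → M i j = 0) (h₁ : ∀ i j, i + j + 1 = r → M i j = -1) :
    (of fun i j : Fin r => M i j).det = (-1) ^ (r + 1).choose 2 := by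
  induction r generalizing M with
  | zero => simp
  | succ r ih =>
    rw [det_succ_row_zero, Finset.sum_eq_single (Fin.last r)]
    · have := ih (fun i j => M (i + 1) j) (fun i j hij => h₀ _ _ (by omega))
        (fun i j hij => h₁ _ _ (by omega))
      have hs : (of fun i j : Fin (r + 1) => M i j).submatrix Fin.succ (Fin.last r).succAbove =
          of fun i j : Fin r => M (i + 1) j := by
        ext i j; simp
      -- The cofactor sign (-1)^r and the entry -1 supply the exponent r + 1 in C(r+2, 2) = (r + 1)
      -- + C(r+1, 2).
      rw [hs, this, Nat.choose_succ_succ' (r + 1) 1, Nat.choose_one_right, pow_add, pow_succ]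
      simp [h₁ 0 r (by omega)]
    · intro j _ hj
      have : (j : ℕ) < r := Fin.val_lt_last hj
      simp [h₀ 0 j (by omega)]
    · simp

/-- The change of basis P from the powers of X is lower unitriangular, and the Gram matrix is P H Pᵀ
with H the Hankel matrix. -/
theorem det_gram_eq_of_monic (φ : ℤ[X] →ₗ[ℤ] ℤ) (b : ℕ → ℤ[X]) (hb : ∀ i, (b i).Monic)
    (hd : ∀ i, (b i).natDegree = i) (n : ℕ) :
    (of fun i j : Fin n => φ (b i * b j)).det =
      (of fun i j : Fin n => φ (X ^ ((i : ℕ) + (j : ℕ)))).det := by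
  set P : Matrix (Fin n) (Fin n) ℤ := of fun i s => (b i).coeff s with hP
  have hdet : P.det = 1 := by
    rw [det_of_isLowerTriangular]
    · refine Finset.prod_eq_one fun i _ => ?_
      have := (hb i).coeff_natDegree
      rwa [hd] at this
    · intro i j hij
      exact coeff_eq_zero_of_natDegree_lt (by rw [hd]; exact hij)
  have hsum : ∀ i : Fin n, b i = ∑ s : Fin n, (b i).coeff s • X ^ (s : ℕ) := by
    intro i
    conv_lhs => rw [(b i).as_sum_range_C_mul_X_pow' (n := n) (by rw [hd]; exact i.2)]
    rw [Finset.sum_range]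
    simp only [smul_eq_C_mul]
  have hmul : (of fun i j : Fin n => φ (b i * b j)) =
      P * (of fun i j : Fin n => φ (X ^ ((i : ℕ) + (j : ℕ)))) * Pᵀ := by
    ext i j
    rw [of_apply, hsum i, hsum j, Finset.sum_mul_sum, map_sum]
    simp only [mul_apply, map_sum, Finset.sum_mul, transpose_apply, hP, of_apply]
    rw [Finset.sum_comm]
    refine Finset.sum_congr rfl fun s _ => Finset.sum_congr rfl fun t _ => ?_
    rw [smul_mul_smul_comm, ← pow_add, map_smul, smul_eq_mul]
    ring
  rw [hmul, det_mul, det_mul, det_transpose, hdet, one_mul, mul_one]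

end Matrix

/-! ### Chebyshev polynomials and the polynomials U and V -/

/-- Monicity is not asked of p 0, because `Chebyshev.C` starts with the constant 2. -/
theorem monic_natDegree_of_recurrence (p : ℕ → ℤ[X]) (h₀ : (p 0).natDegree = 0)
    (h₁ : (p 1).Monic) (h₁' : (p 1).natDegree = 1)
    (h : ∀ n, p (n + 2) = X * p (n + 1) - p n) (n : ℕ) :
    (p (n + 1)).Monic ∧ (p (n + 1)).natDegree = n + 1 ∧ (p n).natDegree ≤ n := by
  induction n with
  | zero => exact ⟨h₁, h₁', h₀.le⟩
  | succ n ih =>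
    obtain ⟨hm, hd, hl⟩ := ih
    have hXm : (X * p (n + 1)).Monic := monic_X.mul hm
    have hXd : (X * p (n + 1)).natDegree = n + 2 := by
      rw [monic_X.natDegree_mul hm, natDegree_X, hd]; ring
    have hlt : (p n).natDegree < (X * p (n + 1)).natDegree := by omega
    refine ⟨?_, ?_, hd.le⟩
    · rw [h]; exact hXm.sub_of_left (degree_lt_degree hlt)
    · rw [h, natDegree_sub_eq_left_of_natDegree_lt hlt, hXd]

/-- The polynomial `U` with `U (z + 1 + z⁻¹) = (z ^ (K b) - z ^ (-K b)) / (z ^ K - z ^ (-K))`,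
where `b = a + 1`. -/
noncomputable def stepU (K : ℕ) (a : ℕ) : ℤ[X] :=
  (Chebyshev.S ℤ a).comp ((Chebyshev.C ℤ K).comp (X - C 1))

/-- The polynomial `V` with
`V (z + 1 + z⁻¹) = (z ^ (K (a + 1)) + z ^ (-K a)) / (z ^ K + 1)`. -/
noncomputable def stepV (K : ℕ) (a : ℕ) : ℤ[X] :=
  (Chebyshev.S ℤ a - Chebyshev.S ℤ (a - 1)).comp ((Chebyshev.C ℤ K).comp (X - C 1))

theorem chebyshevC_monic_natDegree {n : ℕ} (hn : n ≠ 0) :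
    (Chebyshev.C ℤ n).Monic ∧ (Chebyshev.C ℤ n).natDegree = n := by
  obtain ⟨n, rfl⟩ := Nat.exists_eq_succ_of_ne_zero hn
  have := monic_natDegree_of_recurrence (fun n => Chebyshev.C ℤ n)
    (by simp only [Nat.cast_zero, Chebyshev.C_zero]; exact natDegree_ofNat 2)
    (by simp [monic_X]) (by simp)
    (fun n => by push_cast; exact Chebyshev.C_add_two ℤ n) n
  exact ⟨this.1, this.2.1⟩

theorem chebyshevS_monic_natDegree (n : ℕ) :
    (Chebyshev.S ℤ n).Monic ∧ (Chebyshev.S ℤ n).natDegree = n := by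
  rcases n with _ | n
  · simp
  have := monic_natDegree_of_recurrence (fun n => Chebyshev.S ℤ n)
    (by simp) (by simp [monic_X]) (by simp)
    (fun n => by push_cast; exact Chebyshev.S_add_two ℤ n) n
  exact ⟨this.1, this.2.1⟩

theorem chebyshevS_sub_monic_natDegree (n : ℕ) :
    (Chebyshev.S ℤ n - Chebyshev.S ℤ (n - 1)).Monic ∧
      (Chebyshev.S ℤ n - Chebyshev.S ℤ (n - 1)).natDegree = n := by
  rcases n with _ | n
  · simp
  have := monic_natDegree_of_recurrence
    (fun n => Chebyshev.S ℤ n - Chebyshev.S ℤ (n - 1))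
    (by simp) (by simpa using monic_X_sub_C (1 : ℤ)) (by simpa using natDegree_X_sub_C (1 : ℤ))
    (fun n => by
      have h₁ := Chebyshev.S_add_two ℤ n
      have h₂ := Chebyshev.S_add_one ℤ n
      push_cast
      rw [show (n : ℤ) + 2 - 1 = n + 1 by ring, add_sub_cancel_right]
      linear_combination h₁ - h₂) n
  exact ⟨this.1, this.2.1⟩

theorem chebyshevC_comp_monic_natDegree {K : ℕ} (hK : K ≠ 0) :
    ((Chebyshev.C ℤ K).comp (X - C 1)).Monic ∧
      ((Chebyshev.C ℤ K).comp (X - C 1)).natDegree = K := by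
  refine ⟨(chebyshevC_monic_natDegree hK).1.comp (monic_X_sub_C 1) ?_, ?_⟩
  · rw [natDegree_X_sub_C]; exact one_ne_zero
  · rw [natDegree_comp, natDegree_X_sub_C, mul_one, (chebyshevC_monic_natDegree hK).2]

theorem stepU_monic {K : ℕ} (hK : K ≠ 0) (a : ℕ) : (stepU K a).Monic :=
  (chebyshevS_monic_natDegree a).1.comp (chebyshevC_comp_monic_natDegree hK).1
    (by rwa [(chebyshevC_comp_monic_natDegree hK).2])

theorem stepU_natDegree {K : ℕ} (hK : K ≠ 0) (a : ℕ) : (stepU K a).natDegree = K * a := by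
  rw [stepU, natDegree_comp, (chebyshevS_monic_natDegree a).2,
    (chebyshevC_comp_monic_natDegree hK).2, mul_comm]

theorem stepV_monic {K : ℕ} (hK : K ≠ 0) (a : ℕ) : (stepV K a).Monic :=
  (chebyshevS_sub_monic_natDegree a).1.comp (chebyshevC_comp_monic_natDegree hK).1
    (by rwa [(chebyshevC_comp_monic_natDegree hK).2])

theorem stepV_natDegree {K : ℕ} (hK : K ≠ 0) (a : ℕ) : (stepV K a).natDegree = K * a := by
  rw [stepV, natDegree_comp, (chebyshevS_sub_monic_natDegree a).2,
    (chebyshevC_comp_monic_natDegree hK).2, mul_comm]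

open LaurentPolynomial in
theorem stepEval_chebyshevC (K : ℕ) :
    stepEval ((Chebyshev.C ℤ K).comp (X - Polynomial.C 1)) = T K + T (-K) := by
  have hX : stepEval (X - Polynomial.C 1) = T 1 + T (-1) := by
    rw [map_sub, stepEval_X, Polynomial.C_1, map_one]; ring
  induction K using Nat.twoStepInduction with
  | zero =>
    simp only [Nat.cast_zero, Chebyshev.C_zero, ofNat_comp, neg_zero, LaurentPolynomial.T_zero]
    rw [map_natCast, one_add_one_eq_two, Nat.cast_ofNat]
  | one => simpa using hX
  | more n h₁ h₂ =>
    push_cast at h₂ ⊢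
    rw [Chebyshev.C_add_two, sub_comp, mul_comp, X_comp, map_sub, map_mul, h₁, h₂, hX]
    simp only [add_mul, mul_add, ← T_add]
    ring_nf

open LaurentPolynomial in
theorem stepEval_stepU (K a : ℕ) :
    (T K - T (-K)) * stepEval (stepU K a) = T (K * (a + 1)) - T (-(K * (a + 1))) := by
  induction a using Nat.twoStepInduction with
  | zero => simp [stepU]
  | one =>
    simp only [stepU, Nat.cast_one, Chebyshev.S_one, X_comp]
    rw [stepEval_chebyshevC]
    simp only [sub_mul, mul_add, ← T_add]
    ring_nf
  | more n h₁ h₂ =>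
    have h : stepEval (stepU K (n + 2)) =
        (T K + T (-K)) * stepEval (stepU K (n + 1)) - stepEval (stepU K n) := by
      rw [← stepEval_chebyshevC, ← map_mul, ← map_sub]
      simp only [stepU]
      push_cast
      rw [Chebyshev.S_add_two, sub_comp, mul_comp, X_comp]
    rw [h, mul_sub, mul_left_comm, h₁, h₂]
    push_cast
    simp only [add_mul, mul_sub, ← T_add]
    ring_nf

open LaurentPolynomial in
theorem stepEval_stepV (K a : ℕ) :
    (1 + T K) * stepEval (stepV K a) = T (K * (a + 1)) + T (-(K * a)) := by
  induction a using Nat.twoStepInduction with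
  | zero => simp [stepV, add_comm]
  | one =>
    simp only [stepV, Nat.cast_one, Chebyshev.S_one, sub_self, Chebyshev.S_zero]
    rw [sub_comp, X_comp, one_comp]
    rw [map_sub, stepEval_chebyshevC, map_one]
    simp only [add_mul, mul_add, mul_sub, ← T_add]
    ring_nf
    simp
    ring
  | more n h₁ h₂ =>
    have h : stepEval (stepV K (n + 2)) =
        (T K + T (-K)) * stepEval (stepV K (n + 1)) - stepEval (stepV K n) := by
      rw [← stepEval_chebyshevC, ← map_mul, ← map_sub]
      simp only [stepV]
      have h₁ := Chebyshev.S_add_two ℤ n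
      have h₂ := Chebyshev.S_add_one ℤ n
      push_cast
      have h₃ : Chebyshev.S ℤ (n + 2) - Chebyshev.S ℤ (n + 2 - 1) =
          X * (Chebyshev.S ℤ (n + 1) - Chebyshev.S ℤ (n + 1 - 1)) -
            (Chebyshev.S ℤ n - Chebyshev.S ℤ (n - 1)) := by
        rw [show (n : ℤ) + 2 - 1 = n + 1 by ring, add_sub_cancel_right]
        linear_combination h₁ - h₂
      rw [h₃, sub_comp (p := X * _), mul_comp, X_comp]
    rw [h, mul_sub, mul_left_comm, h₁, h₂]
    push_cast
    simp only [add_mul, mul_add, ← T_add]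
    ring_nf

/-! ### Collapse of the functional on multiples of V and (X - 3) U -/

theorem prefixFunctional_stepV_mul (k a : ℕ) (P : ℤ[X]) (hP : P.natDegree ≤ (k + 1) * a) :
    prefixFunctional k (stepV (k + 1) a * P) = P.coeff ((k + 1) * a) := by
  have hmul := congrArg (· * stepEval P) (stepEval_stepV (k + 1) a)
  simp only [mul_assoc, ← map_mul] at hmul
  have hcoeff : ∀ t : ℕ, stepCoeff (stepV (k + 1) a * P) (t - k) +
      stepCoeff (stepV (k + 1) a * P) ((t + (k + 1) : ℕ) - k) =
      stepCoeff P ((k + 1) * a + (k - t)) + stepCoeff P ((k + 1) * a + (t + 1)) := by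
    -- Compare coefficients of z^(t+1) in (1 + z^K) V P = (z^(K(a+1)) + z^(-Ka)) P; the index t + 1
    -- - K(a+1) is the negative of Ka + (k - t).
    intro t
    have := congrArg (fun f => AddMonoidAlgebra.coeff f ((t : ℤ) + 1)) hmul
    simp only [add_mul, one_mul, coeff_add_apply, coeff_T_mul] at this
    rw [← stepCoeff_neg P ((k + 1) * a + (k - t))]
    simp only [stepCoeff]
    refine Eq.trans ?_ (this.trans ?_)
    · rw [add_comm]; congr 2 <;> push_cast <;> ring
    · congr 2 <;> push_cast <;> ring
  rw [prefixFunctional_eq_sum_range, show 2 * k + 2 = (k + 1) + (k + 1) by ring,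
    Finset.sum_range_add, ← Finset.sum_add_distrib]
  have hswap : ∀ t : ℕ, k + 1 + t = t + (k + 1) := fun t => add_comm _ _
  simp only [hswap, hcoeff]
  -- For t < k both indices exceed Ka, hence the degree of P; at t = k the first index is exactly
  -- Ka.
  rw [Finset.sum_range_succ, Finset.sum_eq_zero]
  · rw [stepCoeff_of_natDegree_lt P (l := ((k : ℤ) + 1) * a + (k + 1)), zero_add, add_zero, sub_self,
      add_zero, ← stepCoeff_of_natDegree_le P _ hP]
    · push_cast; rfl
    · zify at hP; omega
  · intro t ht
    have := Finset.mem_range.1 ht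
    zify at hP
    rw [stepCoeff_of_natDegree_lt, stepCoeff_of_natDegree_lt, add_zero] <;> omega

theorem prefixFunctional_stepU_mul (k a : ℕ) (P : ℤ[X])
    (hP : P.natDegree + 1 ≤ (k + 1) * (a + 1)) :
    prefixFunctional k ((X - C 3) * stepU (k + 1) a * P) = -P.coeff ((k + 1) * (a + 1) - 1) := by
  open LaurentPolynomial in
  set g : LaurentPolynomial ℤ := (1 - T (-1)) * (stepEval (stepU (k + 1) a) * stepEval P) with hg
  have hX : stepEval (X - Polynomial.C 3) = (T 1 - 1) * (1 - T (-1)) := by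
    have h3 : stepEval (Polynomial.C 3) = 3 := by
      rw [show (Polynomial.C (3 : ℤ)) = 3 from rfl, map_ofNat]
    rw [map_sub, stepEval_X, h3, sub_mul, mul_sub, ← T_add]
    simp
    ring
  have htel : ∀ l, stepCoeff ((X - Polynomial.C 3) * stepU (k + 1) a * P) l =
      g.coeff (l - 1) - g.coeff l := by
    intro l
    rw [stepCoeff, mul_assoc, map_mul, map_mul, hX, mul_assoc, ← hg, sub_mul, one_mul,
      coeff_sub_apply, coeff_T_mul]
  have hsum : prefixFunctional k ((X - Polynomial.C 3) * stepU (k + 1) a * P) =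
      g.coeff (-((k + 1 : ℕ) : ℤ)) - g.coeff ((k + 1 : ℕ) : ℤ) := by
    rw [prefixFunctional_eq_sum_range]
    simp only [htel]
    have := Finset.sum_range_sub' (fun t : ℕ => g.coeff ((t : ℤ) - k - 1)) (2 * k + 2)
    refine Eq.trans (Finset.sum_congr rfl fun t _ => ?_) (this.trans ?_)
    · congr 2; push_cast; ring
    · congr 2 <;> push_cast <;> ring
  have hmul : (T ((k + 1 : ℕ) : ℤ) - T (-((k + 1 : ℕ) : ℤ))) * g = (1 - T (-1)) *
      ((T (((k + 1 : ℕ) : ℤ) * (a + 1)) - T (-(((k + 1 : ℕ) : ℤ) * (a + 1)))) * stepEval P) := by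
    rw [← stepEval_stepU, hg]; ring
  -- The telescoped difference g_(-K) - g_K is the constant term of (z^K - z^(-K)) g.
  have h0 := congrArg (fun f => AddMonoidAlgebra.coeff f 0) hmul
  simp only [sub_mul, one_mul, mul_sub, coeff_sub_apply, coeff_T_mul, zero_sub, neg_neg] at h0
  rw [hsum, h0]
  have hP' : (P.natDegree : ℤ) + 1 ≤ ((k + 1 : ℕ) : ℤ) * (a + 1) := by exact_mod_cast hP
  set N : ℤ := ((k + 1 : ℕ) : ℤ) * (a + 1) with hN
  have hNn : (((k + 1) * (a + 1) - 1 : ℕ) : ℤ) = N - 1 := by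
    rw [hN, Nat.cast_sub (by omega)]; push_cast; ring
  rw [sub_neg_eq_add]
  change stepCoeff P (-N) - stepCoeff P (1 - N) - (stepCoeff P N - stepCoeff P (1 + N)) = _
  -- By symmetry the terms at ±N cancel, N + 1 exceeds the degree, and only minus the coefficient at
  -- N - 1 remains.
  rw [stepCoeff_neg, stepCoeff_of_natDegree_lt P (l := 1 + N) (by omega), ← neg_sub N 1,
    stepCoeff_neg, ← stepCoeff_of_natDegree_le P _ (by omega), hNn]
  ring

/-! ### The block basis and its Gram matrix -/

/-- A basis of monic polynomials which is block orthogonal for `prefixFunctional (K - 1)`. -/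
noncomputable def blockBasis (K i : ℕ) : ℤ[X] :=
  if i % K = 0 then stepV K (i / K) else (X - C 3) * stepU K (i / K) * X ^ (i % K - 1)

theorem blockBasis_monic {K : ℕ} (hK : K ≠ 0) (i : ℕ) : (blockBasis K i).Monic := by
  rw [blockBasis]
  split_ifs
  · exact stepV_monic hK _
  · exact ((monic_X_sub_C 3).mul (stepU_monic hK _)).mul (monic_X_pow _)

theorem blockBasis_natDegree {K : ℕ} (hK : K ≠ 0) (i : ℕ) : (blockBasis K i).natDegree = i := by
  have := Nat.div_add_mod i K
  rw [blockBasis]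
  split_ifs
  · rw [stepV_natDegree hK]; omega
  · rw [((monic_X_sub_C 3).mul (stepU_monic hK _)).natDegree_mul (monic_X_pow _),
      (monic_X_sub_C 3).natDegree_mul (stepU_monic hK _), natDegree_X_sub_C, stepU_natDegree hK,
      natDegree_X_pow]
    omega

theorem blockBasis_mul (K a : ℕ) (hK : K ≠ 0) : blockBasis K (K * a) = stepV K a := by
  rw [blockBasis, Nat.mul_mod_right, if_pos rfl, Nat.mul_div_cancel_left _ (Nat.pos_of_ne_zero hK)]

theorem blockBasis_mul_add (K a s : ℕ) (hs : s + 1 < K) :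
    blockBasis K (K * a + (s + 1)) = (X - C 3) * stepU K a * X ^ s := by
  rw [blockBasis, Nat.mul_add_mod, Nat.mod_eq_of_lt hs, if_neg (by omega),
    Nat.mul_add_div (by omega), Nat.div_eq_of_lt hs, add_zero, Nat.add_sub_cancel]

/-- The Gram matrix of `blockBasis (k + 1)`. -/
noncomputable def blockGram (k i j : ℕ) : ℤ :=
  prefixFunctional k (blockBasis (k + 1) i * blockBasis (k + 1) j)

theorem blockGram_mul_of_lt (k a j : ℕ) (hj : j < (k + 1) * a) :
    blockGram k ((k + 1) * a) j = 0 := by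
  rw [blockGram, blockBasis_mul _ _ k.succ_ne_zero, prefixFunctional_stepV_mul]
  · exact coeff_eq_zero_of_natDegree_lt (by rwa [blockBasis_natDegree k.succ_ne_zero])
  · rw [blockBasis_natDegree k.succ_ne_zero]; exact hj.le

theorem blockGram_mul_self (k a : ℕ) : blockGram k ((k + 1) * a) ((k + 1) * a) = 1 := by
  rw [blockGram, blockBasis_mul _ _ k.succ_ne_zero, prefixFunctional_stepV_mul,
    ← stepV_natDegree k.succ_ne_zero]
  · exact (stepV_monic k.succ_ne_zero a).coeff_natDegree
  · exact (stepV_natDegree k.succ_ne_zero a).le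

theorem blockGram_mul_add (k a s j : ℕ) (hs : s < k) (hj : s + j + 1 ≤ (k + 1) * (a + 1)) :
    blockGram k ((k + 1) * a + (s + 1)) j =
      if s + j + 1 = (k + 1) * (a + 1) then -1 else 0 := by
  have hm : (X ^ s * blockBasis (k + 1) j).Monic :=
    (monic_X_pow s).mul (blockBasis_monic k.succ_ne_zero j)
  have hd : (X ^ s * blockBasis (k + 1) j).natDegree = s + j := by
    rw [(monic_X_pow s).natDegree_mul (blockBasis_monic k.succ_ne_zero j), natDegree_X_pow,
      blockBasis_natDegree k.succ_ne_zero]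
  rw [blockGram, blockBasis_mul_add _ _ _ (by omega), mul_assoc _ (X ^ s),
    prefixFunctional_stepU_mul _ _ _ (by rwa [hd])]
  split_ifs with h
  · rw [← h, Nat.add_sub_cancel, ← hd, hm.coeff_natDegree]
  · rw [coeff_eq_zero_of_natDegree_lt (by omega), neg_zero]

/-- Row i lies in a block c ≥ a, and a column before block a is too small in degree to reach the
coefficient that the functional extracts. -/
theorem blockGram_lower_eq_zero (k a i j : ℕ) (hi : (k + 1) * a ≤ i) (hj : j < (k + 1) * a) :
    blockGram k i j = 0 := by
  obtain ⟨c, r, hr, rfl⟩ : ∃ c r, r < k + 1 ∧ i = (k + 1) * c + r :=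
    ⟨i / (k + 1), i % (k + 1), Nat.mod_lt _ k.succ_pos, (Nat.div_add_mod _ _).symm⟩
  have hac : a ≤ c := by
    by_contra h
    have : (k + 1) * (c + 1) ≤ (k + 1) * a := Nat.mul_le_mul_left _ (by omega)
    rw [mul_add] at this
    omega
  have hle : (k + 1) * a ≤ (k + 1) * c := Nat.mul_le_mul_left _ hac
  rcases r with _ | s
  · exact blockGram_mul_of_lt _ _ _ (by omega)
  · have : (k + 1) * (c + 1) = (k + 1) * c + (k + 1) := by ring
    rw [blockGram_mul_add _ _ _ _ (by omega) (by omega), if_neg (by omega)]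

open Matrix

theorem blockGram_succ_eq_zero (k a i : ℕ) (hi : (k + 1) * a + 1 ≤ i) :
    blockGram k i ((k + 1) * a) = 0 := by
  have hK : (k + 1) * (a + 1) = (k + 1) * a + (k + 1) := by ring
  by_cases h : (k + 1) * (a + 1) ≤ i
  · exact blockGram_lower_eq_zero _ (a + 1) _ _ h (by omega)
  · obtain ⟨s, rfl⟩ : ∃ s, i = (k + 1) * a + (s + 1) := ⟨i - (k + 1) * a - 1, by omega⟩
    rw [blockGram_mul_add _ _ _ _ (by omega) (by omega), if_neg (by omega)]

/-- Below the V_a entry the first column vanishes, so the block splits as 1 + k; the k × k remainder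
is antitriangular. -/
theorem det_blockGram_block (k a : ℕ) :
    (of fun i j : Fin (k + 1) => blockGram k ((k + 1) * a + i) ((k + 1) * a + j)).det =
      (-1) ^ (k + 1).choose 2 := by
  have hK : (k + 1) * (a + 1) = (k + 1) * a + (k + 1) := by ring
  have h := det_fin_add_of_lower_left_eq_zero
    (fun i j => blockGram k ((k + 1) * a + i) ((k + 1) * a + j)) 1 k (fun i j hi hj => by
      obtain rfl : j = 0 := by omega
      exact blockGram_succ_eq_zero _ _ _ (by omega))
  rw [det_antitriangular (fun i j => blockGram k ((k + 1) * a + (1 + i)) ((k + 1) * a + (1 + j)))]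
    at h
  · rw [← det_reindex_self (finCongr (add_comm k 1))]
    refine Eq.trans ?_ (h.trans ?_)
    · rfl
    · rw [det_fin_one, of_apply, Fin.val_zero, add_zero, blockGram_mul_self, one_mul]
  · intro i j hij
    rw [add_comm 1 i, blockGram_mul_add _ _ _ _ (by omega) (by omega), if_neg (by omega)]
  · intro i j hij
    rw [add_comm 1 i, blockGram_mul_add _ _ _ _ (by omega) (by omega), if_pos (by omega)]

theorem det_blockGram_add (k a r : ℕ) :
    (of fun i j : Fin ((k + 1) * a + r) => blockGram k i j).det =
      (of fun i j : Fin ((k + 1) * a) => blockGram k i j).det *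
        (of fun i j : Fin r => blockGram k ((k + 1) * a + i) ((k + 1) * a + j)).det :=
  det_fin_add_of_lower_left_eq_zero _ _ _ (blockGram_lower_eq_zero k a)

theorem det_blockGram_mul (k a : ℕ) :
    (of fun i j : Fin ((k + 1) * a) => blockGram k i j).det =
      (-1) ^ (a * (k + 1).choose 2) := by
  induction a with
  | zero => simp
  | succ a ih =>
    rw [mul_add_one, det_blockGram_add, ih, det_blockGram_block, add_one_mul, pow_add]

theorem det_blockGram_mul_add_one (k a : ℕ) :
    (of fun i j : Fin ((k + 1) * a + 1) => blockGram k i j).det =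
      (-1) ^ (a * (k + 1).choose 2) := by
  rw [det_blockGram_add, det_blockGram_mul, det_fin_one, of_apply, Fin.val_zero, add_zero,
    blockGram_mul_self, mul_one]

theorem det_blockGram_mul_add_eq_zero (k a r : ℕ) (hr : 2 ≤ r) (hrk : r ≤ k) :
    (of fun i j : Fin ((k + 1) * a + r) => blockGram k i j).det = 0 := by
  -- In row 1 of the block, that of (X - 3) U_a, the first nonzero entry is in column k, which is
  -- cut off since r ≤ k.
  rw [det_blockGram_add, det_eq_zero_of_row_eq_zero (A := of fun i j : Fin r => _) ⟨1, hr⟩,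
    mul_zero]
  intro j
  have hK : (k + 1) * (a + 1) = (k + 1) * a + (k + 1) := by ring
  have := j.2
  rw [of_apply, blockGram_mul_add _ _ 0 _ (by omega) (by omega), if_neg (by omega)]

/-! ### Linearity and the final evaluation -/

theorem prefixFunctional_add (k : ℕ) (P Q : ℤ[X]) :
    prefixFunctional k (P + Q) = prefixFunctional k P + prefixFunctional k Q := by
  simp only [prefixFunctional, ← Finset.sum_add_distrib, stepCoeff, map_add, coeff_add_apply]

theorem prefixFunctional_smul (k : ℕ) (c : ℤ) (P : ℤ[X]) :
    prefixFunctional k (c • P) = c • prefixFunctional k P := by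
  simp only [prefixFunctional, Finset.smul_sum, stepCoeff, map_smul]
  rfl

theorem det_motzkinPrefix_eq_det_blockGram (n k : ℕ) :
    (of fun i j : Fin n => (motzkinPrefix ((i : ℕ) + (j : ℕ)) k : ℤ)).det =
      (of fun i j : Fin n => blockGram k i j).det := by
  simp only [motzkinPrefix_eq_prefixFunctional]
  exact (det_gram_eq_of_monic
    ⟨⟨prefixFunctional k, prefixFunctional_add k⟩, prefixFunctional_smul k⟩
    (blockBasis (k + 1)) (blockBasis_monic k.succ_ne_zero)
    (blockBasis_natDegree k.succ_ne_zero) n).symm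

theorem corollary15 (n k : ℕ) (hn : 0 < n) :
    (Matrix.of fun i j : Fin n => (motzkinPrefix ((i : ℕ) + (j : ℕ)) k : ℤ)).det =
        (Matrix.of fun i j : Fin n => (trinomialSum ((i : ℕ) + (j : ℕ)) k : ℤ)).det ∧
      (∀ n₁ : ℕ, n = (k + 1) * n₁ ∨ n = (k + 1) * n₁ + 1 →
        (Matrix.of fun i j : Fin n => (motzkinPrefix ((i : ℕ) + (j : ℕ)) k : ℤ)).det =
          (-1) ^ (n₁ * (k + 1).choose 2)) ∧
      (¬ n ≡ 0 [MOD k + 1] → ¬ n ≡ 1 [MOD k + 1] →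
        (Matrix.of fun i j : Fin n => (motzkinPrefix ((i : ℕ) + (j : ℕ)) k : ℤ)).det = 0) ∧
      (Matrix.of fun i j : Fin n => (motzkinPrefix ((i : ℕ) + (j : ℕ)) 0 : ℤ)).det = 1 := by
  refine ⟨?_, ?_, ?_, ?_⟩
  · simp only [motzkinPrefix_eq_prefixFunctional, prefixFunctional_X_pow]
  · rintro a (rfl | rfl)
    · rw [det_motzkinPrefix_eq_det_blockGram, det_blockGram_mul]
    · rw [det_motzkinPrefix_eq_det_blockGram, det_blockGram_mul_add_one]
  · intro h₀ h₁
    obtain ⟨a, r, hr, rfl⟩ : ∃ a r, r < k + 1 ∧ n = (k + 1) * a + r :=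
      ⟨n / (k + 1), n % (k + 1), Nat.mod_lt _ k.succ_pos, (Nat.div_add_mod _ _).symm⟩
    have hr₀ : r ≠ 0 := by
      rintro rfl
      exact h₀ (by simp [Nat.ModEq])
    have hr₁ : r ≠ 1 := by
      rintro rfl
      exact h₁ (by simp [Nat.ModEq])
    rw [det_motzkinPrefix_eq_det_blockGram,
      det_blockGram_mul_add_eq_zero k a r (by omega) (by omega)]
  · rw [det_motzkinPrefix_eq_det_blockGram]
    -- For k = 0 the blocks have size 1 and C(1, 2) = 0. The dimension is generalised because `Fin
    -- n` and `Fin ((0 + 1) * n)` are different types syntactically.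
    have h : ∀ m, m = (0 + 1) * n → (of fun i j : Fin m => blockGram 0 i j).det = 1 := by
      rintro _ rfl
      rw [det_blockGram_mul]
      simp
    exact h n (by simp)
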